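/- Let $N \ge 1$ and let $\Phi : \mathbb{R}^N \to \mathbb{R}$ be the support function of the Euclidean unit ball, $\Phi(\Theta) = \max_{\|w\|_2 \le 1} \langle w, \Theta\rangle = \|\Theta\|_2$. For $\eta > 0$ let $$\tilde\Phi(\Theta; \eta, \mathcal{N}(0,I)) = \mathbb{E}_{u \sim \mathcal{N}(0,I)}\big[\Phi(\Theta + \eta u)\big]$$ be its Gaussian smoothing with scaling parameter $\eta$ and identity covariance. Then for every $\eta > 0$ this expectation exists (the integrand is integrable) for every $\Theta \in \mathbb{R}^N$, the function $\tilde\Phi(\cdot\,; \eta, \mathcal{N}(0,I))$ is twice differentiable on $\mathbb{R}^N$, and for all $\Theta \in \mathbb{R}^N$ its Hessian matrix satisfies $$\nabla^2 \tilde\Phi(\Theta; \eta, \mathcal{N}(0,I)) \preceq \frac{1}{\eta\sqrt{N}}\, I,$$ where $A \preceq B$ means that $B - A$ is (symmetric) positive semidefinite. -/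

import Mathlib

open MeasureTheory ProbabilityTheory

/-- The baseline potential (support function) of a decision set `X ⊆ ℝ^N`:
`Φ(Θ) = max_{w ∈ X} ⟨w, Θ⟩`. -/
noncomputable def baselinePotential {N : ℕ} (X : Set (EuclideanSpace ℝ (Fin N)))
    (Θ : EuclideanSpace ℝ (Fin N)) : ℝ :=
  sSup ((fun w => inner ℝ w Θ) '' X)

/-- The decision set of the Euclidean balls setting: the closed unit ball of `ℝ^N` for `‖·‖₂`. -/
def euclideanDecisionSet (N : ℕ) : Set (EuclideanSpace ℝ (Fin N)) :=
  {w | ‖w‖ ≤ 1}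

/-- In the Euclidean balls setting the supremum is a maximum, with value `‖Θ‖₂`. -/
theorem isGreatest_norm_euclideanDecisionSet {N : ℕ} (Θ : EuclideanSpace ℝ (Fin N)) :
    IsGreatest ((fun w => inner ℝ w Θ) '' euclideanDecisionSet N) ‖Θ‖ := by
  constructor
  · refine ⟨‖Θ‖⁻¹ • Θ, ?_, ?_⟩
    · change ‖‖Θ‖⁻¹ • Θ‖ ≤ 1
      rw [norm_smul, norm_inv, norm_norm]
      exact inv_mul_le_one
    · change inner ℝ (‖Θ‖⁻¹ • Θ) Θ = ‖Θ‖
      rw [real_inner_smul_left, real_inner_self_eq_norm_sq]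
      rcases eq_or_ne ‖Θ‖ 0 with h | h
      · simp [h]
      · field_simp
  · rintro _ ⟨w, hw, rfl⟩
    have hw1 : ‖w‖ ≤ 1 := hw
    exact (real_inner_le_norm w Θ).trans (mul_le_of_le_one_left (norm_nonneg _) hw1)

/-- In the Euclidean balls setting the baseline potential is the Euclidean norm. -/
theorem baselinePotential_euclideanDecisionSet {N : ℕ} (Θ : EuclideanSpace ℝ (Fin N)) :
    baselinePotential (euclideanDecisionSet N) Θ = ‖Θ‖ :=
  (isGreatest_norm_euclideanDecisionSet Θ).csSup_eq

/-- Gaussian smoothing with scaling parameter `η` and covariance matrix `S`: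
`Φ̃(Θ; η, N(0, S)) = E_{u ∼ N(0, S)} Φ(Θ + η u)`. -/
noncomputable def gaussianSmoothing {N : ℕ} (Φ : EuclideanSpace ℝ (Fin N) → ℝ) (η : ℝ)
    (S : Matrix (Fin N) (Fin N) ℝ) (Θ : EuclideanSpace ℝ (Fin N)) : ℝ :=
  ∫ u, Φ (Θ + η • u) ∂(multivariateGaussian 0 S)

/-- The Hessian matrix of `f` at `x`: its `(i, j)` entry is the second derivative of `f` at `x`
applied to the standard basis vectors `e_i`, `e_j`. It is meaningful where `f` is twice
differentiable. -/
noncomputable def hessianMatrix {N : ℕ} (f : EuclideanSpace ℝ (Fin N) → ℝ)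
    (x : EuclideanSpace ℝ (Fin N)) : Matrix (Fin N) (Fin N) ℝ :=
  Matrix.of fun i j =>
    fderiv ℝ (fderiv ℝ f) x (EuclideanSpace.single i 1) (EuclideanSpace.single j 1)

open Set Filter Topology

/-! The norm is a mixture of Gaussians: `κ r = ∫₀^∞ (1 - exp(-t²r²/2)) / t² dt` with `κ` =
`normMixtureConst`. Averaging over `u` under the integral leaves explicit Gaussian integrals, so the
smoothing is `g(‖Θ‖²)`, where `g` = `radialProfile` can be differentiated under the integral sign
even at `0`, where the norm itself is not smooth.

The Hessian is `2g'(q) I + 4g''(q) ΘΘᵀ` with `q = ‖Θ‖²`. The formulas show `g'' ≤ 0` and `g'(q) ≤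
g'(0)`, so the Hessian is at most `2g'(0) I`. Integration by parts in `t`
(`integral_radialIntegrand_zero`) gives `2g'(0) = E‖u‖ / (Nη)`, and `E‖u‖ ≤ √N` because `E‖u‖² = N`.
-/

/-! ### Gaussian integrals and moments. -/

theorem integral_exp_neg_sq_affine_gaussianReal (t η a : ℝ) :
    ∫ u, Real.exp (-(t ^ 2 * (a + η * u) ^ 2 / 2)) ∂(gaussianReal 0 1) =
      (√(1 + (t * η) ^ 2))⁻¹ * Real.exp (-(t ^ 2 * a ^ 2 / (2 * (1 + (t * η) ^ 2)))) := by
  have hD : 0 < 1 + (t * η) ^ 2 := by positivity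
  set D := 1 + (t * η) ^ 2 with hDdef
  rw [integral_gaussianReal_eq_integral_smul one_ne_zero]
  -- Complete the square in `u`; the shift disappears by translation invariance.
  have h : ∀ u : ℝ, gaussianPDFReal 0 1 u • Real.exp (-(t ^ 2 * (a + η * u) ^ 2 / 2)) =
      ((√(2 * Real.pi))⁻¹ * Real.exp (-(t ^ 2 * a ^ 2 / (2 * D)))) *
        Real.exp (-(D / 2) * (u + t ^ 2 * η * a / D) ^ 2) := by
    intro u
    simp only [gaussianPDFReal, smul_eq_mul, NNReal.coe_one, mul_one, sub_zero]
    rw [mul_assoc, mul_assoc, ← Real.exp_add, ← Real.exp_add]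
    congr 2
    field_simp
    rw [hDdef]
    ring
  simp_rw [h]
  rw [integral_const_mul,
    integral_add_right_eq_self (fun u : ℝ => Real.exp (-(D / 2) * u ^ 2)) (t ^ 2 * η * a / D),
    integral_gaussian]
  have : √(Real.pi / (D / 2)) = √(2 * Real.pi) * (√D)⁻¹ := by
    rw [← Real.sqrt_inv, ← Real.sqrt_mul (by positivity)]
    congr 1
    field_simp
  rw [this]
  have : √(2 * Real.pi) ≠ 0 := by positivity
  field_simp

theorem integral_exp_neg_norm_sq_affine_stdGaussian {N : ℕ} (t η : ℝ)
    (Θ : EuclideanSpace ℝ (Fin N)) :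
    ∫ u, Real.exp (-((t * ‖Θ + η • u‖) ^ 2 / 2)) ∂(stdGaussian (EuclideanSpace ℝ (Fin N))) =
      (√(1 + (t * η) ^ 2))⁻¹ ^ N *
        Real.exp (-(t ^ 2 * ‖Θ‖ ^ 2 / (2 * (1 + (t * η) ^ 2)))) := by
  rw [← map_pi_eq_stdGaussian, integral_map (by fun_prop)
    (Measurable.aestronglyMeasurable (by fun_prop))]
  simp_rw [mul_pow t ‖_‖, EuclideanSpace.real_norm_sq_eq, Finset.mul_sum, Finset.sum_div,
    ← Finset.sum_neg_distrib, Real.exp_sum]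
  have := integral_fintype_prod_eq_prod (ι := Fin N) (μ := fun _ => gaussianReal 0 1)
    (f := fun i x => Real.exp (-(t ^ 2 * (Θ i + η * x) ^ 2 / 2)))
  simp only [PiLp.add_apply, PiLp.smul_apply, smul_eq_mul]
  rw [this]
  simp_rw [integral_exp_neg_sq_affine_gaussianReal, Finset.prod_mul_distrib]
  simp

theorem integrable_norm_affine_stdGaussian {N : ℕ} (η : ℝ) (Θ : EuclideanSpace ℝ (Fin N)) :
    Integrable (fun u => ‖Θ + η • u‖) (stdGaussian (EuclideanSpace ℝ (Fin N))) :=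
  ((integrable_const Θ).add (IsGaussian.integrable_id.smul η)).norm

theorem integral_norm_sq_stdGaussian (N : ℕ) :
    ∫ u, ‖u‖ ^ 2 ∂(stdGaussian (EuclideanSpace ℝ (Fin N))) = N := by
  rw [← map_pi_eq_stdGaussian, integral_map (by fun_prop)
    (Measurable.aestronglyMeasurable (by fun_prop))]
  have hi : Integrable (fun x : ℝ => x ^ 2) (gaussianReal 0 1) :=
    (IsGaussian.memLp_two_id (μ := gaussianReal 0 1)).integrable_sq
  have h1 : ∫ x, x ^ 2 ∂(gaussianReal 0 1) = 1 := by
    have := variance_id_gaussianReal (μ := 0) (v := 1)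
    rw [variance_of_integral_eq_zero (by fun_prop) (by simp)] at this
    simpa using this
  simp_rw [EuclideanSpace.real_norm_sq_eq]
  rw [integral_finsetSum]
  · simp_rw [integral_comp_eval (μ := fun _ : Fin N => gaussianReal 0 1)
      (f := fun x : ℝ => x ^ 2) hi.aestronglyMeasurable, h1]
    simp
  · intro i _
    exact integrable_comp_eval (μ := fun _ : Fin N => gaussianReal 0 1) hi

theorem integral_norm_stdGaussian_le (N : ℕ) :
    ∫ u, ‖u‖ ∂(stdGaussian (EuclideanSpace ℝ (Fin N))) ≤ √(N : ℝ) := by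
  have hm : MemLp (fun u => ‖u‖) 2 (stdGaussian (EuclideanSpace ℝ (Fin N))) :=
    IsGaussian.memLp_two_id.norm
  have h := variance_nonneg (fun u => ‖u‖) (stdGaussian (EuclideanSpace ℝ (Fin N)))
  rw [variance_eq_sub hm] at h
  simp only [Pi.pow_apply, integral_norm_sq_stdGaussian] at h
  exact Real.le_sqrt_of_sq_le (by linarith)

/-! ### The norm as a mixture of Gaussians. -/

/-- Combines `1 - exp(-x) ≤ x`, which controls `t` near `0`, with `1 - exp(-x) ≤ 1`, which controls
large `t`. -/
theorem one_sub_exp_div_sq_le (r t : ℝ) (ht : 0 < t) :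
    (1 - Real.exp (-((t * r) ^ 2 / 2))) / t ^ 2 ≤ (1 + r ^ 2 / 2) * (1 + t ^ 2)⁻¹ := by
  have h1 := Real.add_one_le_exp (-((t * r) ^ 2 / 2))
  have h2 := Real.exp_pos (-((t * r) ^ 2 / 2))
  rw [← div_eq_mul_inv, div_le_div_iff₀ (by positivity) (by positivity)]
  nlinarith [mul_pos ht ht, sq_nonneg (t * r), mul_pos (mul_pos ht ht) h2]

theorem one_sub_exp_div_sq_nonneg (r t : ℝ) :
    0 ≤ (1 - Real.exp (-((t * r) ^ 2 / 2))) / t ^ 2 := by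
  have : Real.exp (-((t * r) ^ 2 / 2)) ≤ 1 := Real.exp_le_one_iff.2 (by
    have := sq_nonneg (t * r); linarith)
  exact div_nonneg (by linarith) (sq_nonneg t)

theorem integrableOn_one_sub_exp_div_sq (r : ℝ) :
    IntegrableOn (fun t : ℝ => (1 - Real.exp (-((t * r) ^ 2 / 2))) / t ^ 2) (Ioi 0) := by
  refine Integrable.mono' ((integrable_inv_one_add_sq.const_mul (1 + r ^ 2 / 2)).integrableOn)
    (Measurable.aestronglyMeasurable (by fun_prop)) ?_
  refine (ae_restrict_iff' measurableSet_Ioi).2 (.of_forall fun t ht => ?_)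
  rw [Real.norm_of_nonneg (one_sub_exp_div_sq_nonneg r t)]
  exact one_sub_exp_div_sq_le r t ht

/-- The constant `∫₀^∞ (1 - exp(-t² / 2)) / t² dt` in the representation of the Euclidean norm as a
mixture of Gaussians. -/
noncomputable def normMixtureConst : ℝ :=
  ∫ t in Ioi (0 : ℝ), (1 - Real.exp (-(t ^ 2 / 2))) / t ^ 2

theorem normMixtureConst_pos : 0 < normMixtureConst := by
  have hi := integrableOn_one_sub_exp_div_sq 1
  simp only [mul_one] at hi
  rw [normMixtureConst, setIntegral_pos_iff_support_of_nonneg_ae (.of_forall fun t => by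
    simpa using one_sub_exp_div_sq_nonneg 1 t) hi]
  refine lt_of_lt_of_le ?_ (measure_mono (s := Ioi (0 : ℝ)) ?_)
  · simp
  · intro t ht
    have ht' : (0 : ℝ) < t := ht
    refine ⟨?_, ht⟩
    have : Real.exp (-(t ^ 2 / 2)) < 1 := by
      rw [← Real.exp_zero, Real.exp_lt_exp]
      have : 0 < t ^ 2 := by positivity
      linarith
    exact (div_pos (by linarith) (by positivity)).ne'

theorem integral_one_sub_exp_div_sq {r : ℝ} (hr : 0 ≤ r) :
    ∫ t in Ioi (0 : ℝ), (1 - Real.exp (-((t * r) ^ 2 / 2))) / t ^ 2 = normMixtureConst * r := by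
  rcases hr.eq_or_lt with rfl | hr
  · simp
  have h := integral_comp_mul_right_Ioi
    (fun t : ℝ => (1 - Real.exp (-(t ^ 2 / 2))) / t ^ 2) 0 hr
  rw [zero_mul] at h
  have h2 : ∀ t : ℝ, (1 - Real.exp (-((t * r) ^ 2 / 2))) / t ^ 2 =
      r ^ 2 * ((1 - Real.exp (-((t * r) ^ 2 / 2))) / (t * r) ^ 2) := by
    intro t
    rcases eq_or_ne t 0 with rfl | ht
    · simp
    · field_simp
  simp_rw [h2]
  rw [integral_const_mul, h, smul_eq_mul, normMixtureConst]
  field_simp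

/-! ### Averaging the mixture over `u`. -/

/-- The integrand of the Gaussian mixture representation of `E ‖Θ + η u‖`, as a function of
`q = ‖Θ‖ ^ 2`. -/
noncomputable def radialIntegrand (N : ℕ) (η q t : ℝ) : ℝ :=
  (1 - (√(1 + (t * η) ^ 2))⁻¹ ^ N * Real.exp (-(t ^ 2 * q / (2 * (1 + (t * η) ^ 2))))) / t ^ 2

/-- The derivative of `radialIntegrand` in `q`. -/
noncomputable def radialIntegrandDeriv (N : ℕ) (η q t : ℝ) : ℝ :=
  1 / 2 * (√(1 + (t * η) ^ 2))⁻¹ ^ (N + 2) *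
    Real.exp (-(t ^ 2 * q / (2 * (1 + (t * η) ^ 2))))

/-- The second derivative of `radialIntegrand` in `q`. -/
noncomputable def radialIntegrandDerivTwo (N : ℕ) (η q t : ℝ) : ℝ :=
  -(1 / 4 * t ^ 2 * (√(1 + (t * η) ^ 2))⁻¹ ^ (N + 4) *
    Real.exp (-(t ^ 2 * q / (2 * (1 + (t * η) ^ 2)))))

/-- Justifies Fubini: the integrand is nonnegative and its `t`-integral is a multiple of `‖Θ + η •
u‖`, which is integrable in `u`. -/
theorem integrable_prod_one_sub_exp_div_sq {N : ℕ} (η : ℝ) (Θ : EuclideanSpace ℝ (Fin N)) :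
    Integrable (Function.uncurry fun (u : EuclideanSpace ℝ (Fin N)) (t : ℝ) =>
        (1 - Real.exp (-((t * ‖Θ + η • u‖) ^ 2 / 2))) / t ^ 2)
      ((stdGaussian (EuclideanSpace ℝ (Fin N))).prod (volume.restrict (Ioi 0))) := by
  have hm : Measurable fun p : EuclideanSpace ℝ (Fin N) × ℝ =>
      (1 - Real.exp (-((p.2 * ‖Θ + η • p.1‖) ^ 2 / 2))) / p.2 ^ 2 := by fun_prop
  have hn : ∀ u : EuclideanSpace ℝ (Fin N),
      ∫ t in Ioi (0 : ℝ), ‖(1 - Real.exp (-((t * ‖Θ + η • u‖) ^ 2 / 2))) / t ^ 2‖ =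
        normMixtureConst * ‖Θ + η • u‖ := by
    intro u
    rw [← integral_one_sub_exp_div_sq (norm_nonneg _)]
    exact integral_congr_ae (.of_forall fun t =>
      Real.norm_of_nonneg (one_sub_exp_div_sq_nonneg _ t))
  have hi := (integrable_norm_affine_stdGaussian η Θ).const_mul normMixtureConst
  refine (integrable_prod_iff hm.aestronglyMeasurable).2
    ⟨.of_forall fun u => integrableOn_one_sub_exp_div_sq ‖Θ + η • u‖, ?_⟩
  simp_rw [← hn] at hi
  exact hi

theorem integral_one_sub_exp_div_sq_stdGaussian {N : ℕ} (η t : ℝ)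
    (Θ : EuclideanSpace ℝ (Fin N)) :
    ∫ u, (1 - Real.exp (-((t * ‖Θ + η • u‖) ^ 2 / 2))) / t ^ 2
      ∂(stdGaussian (EuclideanSpace ℝ (Fin N))) = radialIntegrand N η (‖Θ‖ ^ 2) t := by
  have hi : Integrable (fun u => Real.exp (-((t * ‖Θ + η • u‖) ^ 2 / 2)))
      (stdGaussian (EuclideanSpace ℝ (Fin N))) := by
    refine Integrable.mono' (integrable_const (1 : ℝ))
      (Measurable.aestronglyMeasurable (by fun_prop)) (.of_forall fun u => ?_)
    rw [Real.norm_of_nonneg (Real.exp_pos _).le, Real.exp_le_one_iff]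
    have := sq_nonneg (t * ‖Θ + η • u‖)
    linarith
  rw [integral_div, integral_sub (integrable_const _) hi,
    integral_exp_neg_norm_sq_affine_stdGaussian, radialIntegrand]
  simp

theorem integrableOn_radialIntegrand {N : ℕ} (η : ℝ) (Θ : EuclideanSpace ℝ (Fin N)) :
    IntegrableOn (radialIntegrand N η (‖Θ‖ ^ 2)) (Ioi 0) := by
  have := (integrable_prod_one_sub_exp_div_sq η Θ).integral_prod_right
  simpa only [Function.uncurry_apply_pair, integral_one_sub_exp_div_sq_stdGaussian] using! this

theorem integral_radialIntegrand {N : ℕ} (η : ℝ) (Θ : EuclideanSpace ℝ (Fin N)) :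
    ∫ t in Ioi 0, radialIntegrand N η (‖Θ‖ ^ 2) t =
      normMixtureConst * ∫ u, ‖Θ + η • u‖ ∂(stdGaussian (EuclideanSpace ℝ (Fin N))) := by
  rw [← integral_const_mul]
  simp_rw [← integral_one_sub_exp_div_sq (norm_nonneg _),
    ← integral_one_sub_exp_div_sq_stdGaussian]
  exact (integral_integral_swap (integrable_prod_one_sub_exp_div_sq η Θ)).symm

/-! ### Domination and differentiation under the integral in `q`. -/

theorem inv_sqrt_sq_one_add (x : ℝ) : (√(1 + x ^ 2))⁻¹ ^ 2 = (1 + x ^ 2)⁻¹ := by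
  rw [inv_pow, Real.sq_sqrt (by positivity)]

theorem inv_sqrt_one_add_sq_le_one (x : ℝ) : (√(1 + x ^ 2))⁻¹ ≤ 1 :=
  inv_le_one_of_one_le₀ (Real.one_le_sqrt.2 (by nlinarith [sq_nonneg x]))

theorem inv_sqrt_one_add_sq_pow_add_two_le (N : ℕ) (x : ℝ) :
    (√(1 + x ^ 2))⁻¹ ^ (N + 2) ≤ (1 + x ^ 2)⁻¹ := by
  rw [pow_add, inv_sqrt_sq_one_add]
  exact mul_le_of_le_one_left (by positivity)
    (pow_le_one₀ (by positivity) (inv_sqrt_one_add_sq_le_one x))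

theorem integrable_inv_one_add_mul_sq {η : ℝ} (hη : 0 < η) :
    Integrable (fun t : ℝ => (1 + (t * η) ^ 2)⁻¹) :=
  integrable_inv_one_add_sq.comp_mul_right' hη.ne'

theorem sq_div_one_add_mul_sq_le {η : ℝ} (hη : 0 < η) (t : ℝ) :
    t ^ 2 / (1 + (t * η) ^ 2) ≤ 1 / η ^ 2 := by
  rw [div_le_div_iff₀ (by positivity) (by positivity)]
  nlinarith

/-- Negative `q` must be allowed: differentiating at `q = 0` needs a two-sided neighbourhood. The
bound is uniform in `t` because `t² / (1 + t²η²)` is bounded. -/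
theorem exp_neg_sq_mul_div_le {η : ℝ} (hη : 0 < η) {q R : ℝ} (hq : |q| ≤ R) (t : ℝ) :
    Real.exp (-(t ^ 2 * q / (2 * (1 + (t * η) ^ 2)))) ≤ Real.exp (R / η ^ 2) := by
  rw [Real.exp_le_exp]
  have h := sq_div_one_add_mul_sq_le hη t
  have h0 : 0 ≤ t ^ 2 / (1 + (t * η) ^ 2) := by positivity
  have hR : 0 ≤ R := (abs_nonneg q).trans hq
  have e : -(t ^ 2 * q / (2 * (1 + (t * η) ^ 2))) = t ^ 2 / (1 + (t * η) ^ 2) * (-q / 2) := by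
    field_simp
  rw [e]
  calc t ^ 2 / (1 + (t * η) ^ 2) * (-q / 2) ≤ t ^ 2 / (1 + (t * η) ^ 2) * R := by
        refine mul_le_mul_of_nonneg_left ?_ h0
        have := neg_abs_le q
        linarith
    _ ≤ 1 / η ^ 2 * R := mul_le_mul_of_nonneg_right h hR
    _ = R / η ^ 2 := by ring

theorem hasDerivAt_exp_neg_sq_mul_div (η q t : ℝ) :
    HasDerivAt (fun q => Real.exp (-(t ^ 2 * q / (2 * (1 + (t * η) ^ 2)))))
      (-(t ^ 2 / (2 * (1 + (t * η) ^ 2))) *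
        Real.exp (-(t ^ 2 * q / (2 * (1 + (t * η) ^ 2))))) q := by
  have h := ((((hasDerivAt_id q).const_mul (t ^ 2)).div_const (2 * (1 + (t * η) ^ 2))).neg).exp
  refine h.congr_deriv ?_
  simp only [id, mul_one, Pi.neg_apply]
  ring

theorem hasDerivAt_radialIntegrand (N : ℕ) (η q : ℝ) {t : ℝ} (ht : 0 < t) :
    HasDerivAt (fun q => radialIntegrand N η q t) (radialIntegrandDeriv N η q t) q := by
  have h := (((hasDerivAt_exp_neg_sq_mul_div η q t).const_mul
    ((√(1 + (t * η) ^ 2))⁻¹ ^ N)).const_sub 1).div_const (t ^ 2)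
  refine h.congr_deriv ?_
  rw [radialIntegrandDeriv, pow_add, inv_sqrt_sq_one_add]
  have : 1 + (t * η) ^ 2 ≠ 0 := by positivity
  field_simp

theorem hasDerivAt_radialIntegrandDeriv (N : ℕ) (η q t : ℝ) :
    HasDerivAt (fun q => radialIntegrandDeriv N η q t) (radialIntegrandDerivTwo N η q t) q := by
  have h := (hasDerivAt_exp_neg_sq_mul_div η q t).const_mul
    (1 / 2 * (√(1 + (t * η) ^ 2))⁻¹ ^ (N + 2))
  refine h.congr_deriv ?_
  rw [radialIntegrandDerivTwo, show N + 4 = N + 2 + 2 from rfl, pow_add _ (N + 2),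
    inv_sqrt_sq_one_add]
  have : 1 + (t * η) ^ 2 ≠ 0 := by positivity
  field_simp
  ring

theorem radialIntegrandDeriv_nonneg (N : ℕ) (η q t : ℝ) : 0 ≤ radialIntegrandDeriv N η q t := by
  unfold radialIntegrandDeriv; positivity

theorem radialIntegrandDerivTwo_nonpos (N : ℕ) (η q t : ℝ) :
    radialIntegrandDerivTwo N η q t ≤ 0 := by
  unfold radialIntegrandDerivTwo
  exact neg_nonpos.2 (by positivity)

theorem radialIntegrandDeriv_le {η : ℝ} (hη : 0 < η) (N : ℕ) {q R : ℝ} (hq : |q| ≤ R) (t : ℝ) :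
    radialIntegrandDeriv N η q t ≤ Real.exp (R / η ^ 2) * (1 + (t * η) ^ 2)⁻¹ := by
  have h1 := inv_sqrt_one_add_sq_pow_add_two_le N (t * η)
  have h2 := exp_neg_sq_mul_div_le hη hq t
  rw [radialIntegrandDeriv, mul_comm (Real.exp (R / η ^ 2))]
  refine mul_le_mul ?_ h2 (Real.exp_pos _).le (by positivity)
  have : 0 ≤ (√(1 + (t * η) ^ 2))⁻¹ ^ (N + 2) := by positivity
  linarith

theorem neg_radialIntegrandDerivTwo_le {η : ℝ} (hη : 0 < η) (N : ℕ) {q R : ℝ} (hq : |q| ≤ R)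
    (t : ℝ) : -radialIntegrandDerivTwo N η q t ≤
      1 / η ^ 2 * (Real.exp (R / η ^ 2) * (1 + (t * η) ^ 2)⁻¹) := by
  have h := radialIntegrandDeriv_le hη N hq t
  have h0 := radialIntegrandDeriv_nonneg N η q t
  have e : -radialIntegrandDerivTwo N η q t =
      (1 / 2 * (t ^ 2 / (1 + (t * η) ^ 2))) * radialIntegrandDeriv N η q t := by
    rw [radialIntegrandDerivTwo, radialIntegrandDeriv, show N + 4 = N + 2 + 2 from rfl,
      pow_add _ (N + 2), inv_sqrt_sq_one_add]
    ring
  rw [e]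
  refine mul_le_mul ?_ h h0 (by positivity)
  have := sq_div_one_add_mul_sq_le hη t
  have : 0 ≤ t ^ 2 / (1 + (t * η) ^ 2) := by positivity
  linarith

@[fun_prop]
theorem measurable_radialIntegrand (N : ℕ) (η q : ℝ) : Measurable (radialIntegrand N η q) := by
  unfold radialIntegrand; fun_prop

@[fun_prop]
theorem measurable_radialIntegrandDeriv (N : ℕ) (η q : ℝ) :
    Measurable (radialIntegrandDeriv N η q) := by
  unfold radialIntegrandDeriv; fun_prop

@[fun_prop]
theorem measurable_radialIntegrandDerivTwo (N : ℕ) (η q : ℝ) :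
    Measurable (radialIntegrandDerivTwo N η q) := by
  unfold radialIntegrandDerivTwo; fun_prop

theorem abs_le_of_mem_ball_one {q p : ℝ} (hp : p ∈ Metric.ball q 1) : |p| ≤ |q| + 1 := by
  have h : |p - q| < 1 := by simpa [Real.dist_eq] using hp
  have := abs_sub_abs_le_abs_sub p q
  linarith

theorem integrable_radialIntegrandDeriv {η : ℝ} (hη : 0 < η) (N : ℕ) (q : ℝ) :
    Integrable (radialIntegrandDeriv N η q) := by
  refine Integrable.mono' ((integrable_inv_one_add_mul_sq hη).const_mul (Real.exp (|q| / η ^ 2)))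
    (by fun_prop) (.of_forall fun t => ?_)
  rw [Real.norm_of_nonneg (radialIntegrandDeriv_nonneg N η q t)]
  exact radialIntegrandDeriv_le hη N le_rfl t

/-- The base point has the form `‖Θ‖ ^ 2` because integrability there is inherited from Fubini. -/
theorem hasDerivAt_integral_radialIntegrand {η : ℝ} (hη : 0 < η) {N : ℕ}
    (Θ : EuclideanSpace ℝ (Fin N)) :
    HasDerivAt (fun q => ∫ t in Ioi 0, radialIntegrand N η q t)
      (∫ t in Ioi 0, radialIntegrandDeriv N η (‖Θ‖ ^ 2) t) (‖Θ‖ ^ 2) := by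
  refine (hasDerivAt_integral_of_dominated_loc_of_deriv_le
    (bound := fun t => Real.exp ((|‖Θ‖ ^ 2| + 1) / η ^ 2) * (1 + (t * η) ^ 2)⁻¹)
    (Metric.ball_mem_nhds (‖Θ‖ ^ 2) one_pos) (.of_forall fun q => by fun_prop)
    (integrableOn_radialIntegrand η Θ) (by fun_prop) (.of_forall fun t p hp => ?_)
    ((integrable_inv_one_add_mul_sq hη).const_mul _).integrableOn
    ((ae_restrict_iff' measurableSet_Ioi).2 (.of_forall fun t ht p _ =>
      hasDerivAt_radialIntegrand N η p ht))).2
  rw [Real.norm_of_nonneg (radialIntegrandDeriv_nonneg N η p t)]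
  exact radialIntegrandDeriv_le hη N (abs_le_of_mem_ball_one hp) t

theorem hasDerivAt_integral_radialIntegrandDeriv {η : ℝ} (hη : 0 < η) (N : ℕ) (q : ℝ) :
    HasDerivAt (fun q => ∫ t in Ioi 0, radialIntegrandDeriv N η q t)
      (∫ t in Ioi 0, radialIntegrandDerivTwo N η q t) q := by
  refine (hasDerivAt_integral_of_dominated_loc_of_deriv_le
    (bound := fun t => 1 / η ^ 2 * (Real.exp ((|q| + 1) / η ^ 2) * (1 + (t * η) ^ 2)⁻¹))
    (Metric.ball_mem_nhds q one_pos) (.of_forall fun q => by fun_prop)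
    (integrable_radialIntegrandDeriv hη N q).integrableOn (by fun_prop)
    (.of_forall fun t p hp => ?_)
    (((integrable_inv_one_add_mul_sq hη).const_mul _).const_mul _).integrableOn
    (.of_forall fun t p _ => hasDerivAt_radialIntegrandDeriv N η p t)).2
  rw [Real.norm_of_nonpos (radialIntegrandDerivTwo_nonpos N η p t)]
  exact neg_radialIntegrandDerivTwo_le hη N (abs_le_of_mem_ball_one hp) t

/-! ### The profile at the origin. -/

theorem hasDerivAt_inv_sqrt_one_add_mul_sq_pow (N : ℕ) (η t : ℝ) :
    HasDerivAt (fun t => (√(1 + (t * η) ^ 2))⁻¹ ^ N)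
      (-(N * η ^ 2 * t * (√(1 + (t * η) ^ 2))⁻¹ ^ (N + 2))) t := by
  have h1 : HasDerivAt (fun t => 1 + (t * η) ^ 2) (2 * t * η ^ 2) t := by
    refine ((((hasDerivAt_id t).mul_const η).pow 2).const_add 1).congr_deriv ?_
    simp only [id]
    ring
  have hs : √(1 + (t * η) ^ 2) ≠ 0 := by positivity
  refine (((h1.sqrt (by positivity)).inv hs).pow N).congr_deriv ?_
  rcases N with _ | n
  · simp
  · simp only [Pi.inv_apply, Nat.add_sub_cancel]
    rw [show n + 1 + 2 = n + 3 from rfl, pow_add _ n 3]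
    field_simp

/-- Integration by parts: the difference of the two integrands is the derivative of `(1 - w t) / t`,
which vanishes at both ends of the half-line. -/
theorem integral_radialIntegrand_zero {η : ℝ} (hη : 0 < η) (N : ℕ) :
    ∫ t in Ioi 0, radialIntegrand N η 0 t =
      2 * (N * η ^ 2) * ∫ t in Ioi 0, radialIntegrandDeriv N η 0 t := by
  have hi := integrableOn_radialIntegrand η (0 : EuclideanSpace ℝ (Fin N))
  simp only [norm_zero, ne_eq, OfNat.ofNat_ne_zero, not_false_eq_true, zero_pow] at hi
  have hi' := (integrable_radialIntegrandDeriv hη N 0).integrableOn (s := Ioi 0)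
  set w : ℝ → ℝ := fun t => (√(1 + (t * η) ^ 2))⁻¹ ^ N
  have hd : ∀ t ∈ Ioi (0 : ℝ), HasDerivAt (fun t => (1 - w t) / t)
      (2 * (N * η ^ 2) * radialIntegrandDeriv N η 0 t - radialIntegrand N η 0 t) t := by
    intro t ht
    have ht' : t ≠ 0 := ne_of_gt ht
    refine (((hasDerivAt_inv_sqrt_one_add_mul_sq_pow N η t).const_sub 1).div
      (hasDerivAt_id t) ht').congr_deriv ?_
    simp only [radialIntegrandDeriv, radialIntegrand, id, mul_zero, zero_div, neg_zero,
      Real.exp_zero, mul_one]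
    field_simp
  -- The quotient is minus a slope of `w` at `0`, where `w' = 0`; this limit agrees with the value
  -- given by division by zero.
  have hc : ContinuousWithinAt (fun t => (1 - w t) / t) (Ici 0) 0 := by
    have h := (hasDerivAt_inv_sqrt_one_add_mul_sq_pow N η 0).const_sub 1
    have h' := h.tendsto_slope
    refine ContinuousAt.continuousWithinAt (continuousAt_iff_punctured_nhds.2 ?_)
    refine (h'.congr fun t => ?_).trans (le_of_eq ?_)
    · simp [slope_def_field, w]
    · simp
  have ht : Tendsto (fun t => (1 - w t) / t) atTop (𝓝 0) := by
    refine squeeze_zero' (g := fun t : ℝ => t⁻¹) ?_ ?_ tendsto_inv_atTop_zero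
    · filter_upwards [eventually_gt_atTop 0] with t ht
      exact div_nonneg (sub_nonneg.2 (pow_le_one₀ (by positivity)
        (inv_sqrt_one_add_sq_le_one _))) ht.le
    · filter_upwards [eventually_gt_atTop 0] with t ht
      rw [← one_div]
      have : 0 ≤ w t := by positivity
      gcongr
      linarith
  have := integral_Ioi_of_hasDerivAt_of_tendsto hc hd ((hi'.const_mul _).sub hi) ht
  rw [integral_sub (hi'.const_mul _) hi, integral_const_mul] at this
  simp only [div_zero, sub_zero] at this
  linarith

/-! ### The radial profile and the Hessian. -/

/-- The radial profile of the smoothed norm: `E ‖Θ + η u‖` as a function of `q = ‖Θ‖ ^ 2`. -/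
noncomputable def radialProfile (N : ℕ) (η q : ℝ) : ℝ :=
  normMixtureConst⁻¹ * ∫ t in Ioi 0, radialIntegrand N η q t

/-- The first derivative of `radialProfile`. -/
noncomputable def radialProfileDeriv (N : ℕ) (η q : ℝ) : ℝ :=
  normMixtureConst⁻¹ * ∫ t in Ioi 0, radialIntegrandDeriv N η q t

/-- The second derivative of `radialProfile`. -/
noncomputable def radialProfileDerivTwo (N : ℕ) (η q : ℝ) : ℝ :=
  normMixtureConst⁻¹ * ∫ t in Ioi 0, radialIntegrandDerivTwo N η q t

theorem gaussianSmoothing_norm_eq_radialProfile {N : ℕ} (η : ℝ) (Θ : EuclideanSpace ℝ (Fin N)) :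
    gaussianSmoothing (baselinePotential (euclideanDecisionSet N)) η 1 Θ =
      radialProfile N η (‖Θ‖ ^ 2) := by
  simp only [gaussianSmoothing, baselinePotential_euclideanDecisionSet,
    multivariateGaussian_zero_one, radialProfile, integral_radialIntegrand]
  rw [inv_mul_cancel_left₀ normMixtureConst_pos.ne']

theorem radialProfileDeriv_le_zero {η : ℝ} (hη : 0 < η) (N : ℕ) {q : ℝ} (hq : 0 ≤ q) :
    radialProfileDeriv N η q ≤ radialProfileDeriv N η 0 := by
  refine mul_le_mul_of_nonneg_left (setIntegral_mono
    (integrable_radialIntegrandDeriv hη N q).integrableOn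
    (integrable_radialIntegrandDeriv hη N 0).integrableOn fun t => ?_)
    (inv_nonneg.2 normMixtureConst_pos.le)
  refine mul_le_mul_of_nonneg_left (Real.exp_le_exp.2 ?_) (by positivity)
  have : 0 ≤ t ^ 2 * q / (2 * (1 + (t * η) ^ 2)) := by positivity
  simpa using this

theorem radialProfileDerivTwo_nonpos (N : ℕ) (η q : ℝ) : radialProfileDerivTwo N η q ≤ 0 :=
  mul_nonpos_of_nonneg_of_nonpos (inv_nonneg.2 normMixtureConst_pos.le)
    (integral_nonpos fun t => radialIntegrandDerivTwo_nonpos N η q t)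

theorem two_mul_radialProfileDeriv_zero_le {η : ℝ} (hη : 0 < η) {N : ℕ} (hN : 0 < N) :
    2 * radialProfileDeriv N η 0 ≤ 1 / (η * √(N : ℝ)) := by
  have h := integral_radialIntegrand_zero hη N
  have h' := integral_radialIntegrand η (0 : EuclideanSpace ℝ (Fin N))
  simp only [norm_zero, ne_eq, OfNat.ofNat_ne_zero, not_false_eq_true, zero_pow, zero_add,
    norm_smul, integral_const_mul, Real.norm_of_nonneg hη.le] at h'
  have hle := integral_norm_stdGaussian_le N
  have hN' : (0 : ℝ) < N := by exact_mod_cast hN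
  have hκ := normMixtureConst_pos
  -- At `Θ = 0` the profile equals `η E‖u‖`, and integration by parts makes it `2Nη² g'(0)`.
  have e : 2 * radialProfileDeriv N η 0 =
      (∫ u, ‖u‖ ∂(stdGaussian (EuclideanSpace ℝ (Fin N)))) / (N * η) := by
    rw [radialProfileDeriv, eq_div_iff (by positivity)]
    rw [h] at h'
    field_simp
    refine mul_left_cancel₀ hη.ne' ?_
    linarith
  have hs : √(N : ℝ) * √(N : ℝ) = N := Real.mul_self_sqrt hN'.le
  rw [e, div_le_div_iff₀ (by positivity) (by positivity), one_mul]
  calc (∫ u, ‖u‖ ∂(stdGaussian (EuclideanSpace ℝ (Fin N)))) * (η * √(N : ℝ))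
      ≤ √(N : ℝ) * (η * √(N : ℝ)) := by gcongr
    _ = N * η := by linear_combination η * hs

/-- The inner product of a real inner product space, linear in both arguments. -/
noncomputable def realInnerSL (E : Type*) [NormedAddCommGroup E] [InnerProductSpace ℝ E] :
    E →L[ℝ] E →L[ℝ] ℝ :=
  innerSL ℝ

@[simp]
theorem realInnerSL_apply {E : Type*} [NormedAddCommGroup E] [InnerProductSpace ℝ E] (x y : E) :
    realInnerSL E x y = inner ℝ x y :=
  rfl

theorem hasFDerivAt_gaussianSmoothing_norm {N : ℕ} {η : ℝ} (hη : 0 < η)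
    (Θ : EuclideanSpace ℝ (Fin N)) :
    HasFDerivAt (gaussianSmoothing (baselinePotential (euclideanDecisionSet N)) η 1)
      ((2 * radialProfileDeriv N η (‖Θ‖ ^ 2)) • realInnerSL _ Θ) Θ := by
  rw [funext (gaussianSmoothing_norm_eq_radialProfile η)]
  have h := ((hasDerivAt_integral_radialIntegrand hη Θ).const_mul
    normMixtureConst⁻¹).comp_hasFDerivAt Θ (hasStrictFDerivAt_norm_sq Θ).hasFDerivAt
  refine h.congr_fderiv ?_
  ext v
  simp [radialProfileDeriv]
  ring

/-- Product rule on `2g'(‖Θ‖²)⟨Θ, ·⟩`; differentiating `‖Θ‖²` contributes the second factor `2` in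
the rank-one term. -/
theorem hasFDerivAt_fderiv_gaussianSmoothing_norm {N : ℕ} {η : ℝ} (hη : 0 < η)
    (Θ : EuclideanSpace ℝ (Fin N)) :
    HasFDerivAt (fderiv ℝ (gaussianSmoothing (baselinePotential (euclideanDecisionSet N)) η 1))
      ((2 * radialProfileDeriv N η (‖Θ‖ ^ 2)) •
          realInnerSL (EuclideanSpace ℝ (Fin N)) +
        ((4 * radialProfileDerivTwo N η (‖Θ‖ ^ 2)) • realInnerSL _ Θ).smulRight
          (realInnerSL _ Θ)) Θ := by
  rw [funext fun x => (hasFDerivAt_gaussianSmoothing_norm hη x).fderiv]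
  have h := (((hasDerivAt_integral_radialIntegrandDeriv hη N (‖Θ‖ ^ 2)).const_mul
    normMixtureConst⁻¹).const_mul 2).comp_hasFDerivAt Θ (hasStrictFDerivAt_norm_sq Θ).hasFDerivAt
  refine (h.smul (realInnerSL (EuclideanSpace ℝ (Fin N))).hasFDerivAt).congr_fderiv ?_
  ext v w
  simp [radialProfileDeriv, radialProfileDerivTwo]
  left
  ring

theorem hessianMatrix_gaussianSmoothing_norm {N : ℕ} {η : ℝ} (hη : 0 < η)
    (Θ : EuclideanSpace ℝ (Fin N)) :
    hessianMatrix (gaussianSmoothing (baselinePotential (euclideanDecisionSet N)) η 1) Θ =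
      (2 * radialProfileDeriv N η (‖Θ‖ ^ 2)) • (1 : Matrix (Fin N) (Fin N) ℝ) +
        (4 * radialProfileDerivTwo N η (‖Θ‖ ^ 2)) • Matrix.vecMulVec Θ.ofLp (star Θ.ofLp) := by
  ext i j
  rw [hessianMatrix, (hasFDerivAt_fderiv_gaussianSmoothing_norm hη Θ).fderiv]
  simp [Matrix.vecMulVec_apply, Matrix.one_apply, PiLp.single_apply,
    EuclideanSpace.inner_single_right, eq_comm]
  ring

theorem lemma4p6 (N : ℕ) (hN : 0 < N) (η : ℝ) (hη : 0 < η) :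
    (∀ Θ : EuclideanSpace ℝ (Fin N),
      Integrable (fun u => baselinePotential (euclideanDecisionSet N) (Θ + η • u))
        (multivariateGaussian 0 (1 : Matrix (Fin N) (Fin N) ℝ))) ∧
    Differentiable ℝ (gaussianSmoothing (baselinePotential (euclideanDecisionSet N)) η 1) ∧
    Differentiable ℝ
      (fderiv ℝ (gaussianSmoothing (baselinePotential (euclideanDecisionSet N)) η 1)) ∧
    ∀ Θ : EuclideanSpace ℝ (Fin N),
      ((1 / (η * √(N : ℝ))) • (1 : Matrix (Fin N) (Fin N) ℝ) -
        hessianMatrix (gaussianSmoothing (baselinePotential (euclideanDecisionSet N)) η 1)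
          Θ).PosSemidef := by
  refine ⟨fun Θ => ?_, fun Θ => (hasFDerivAt_gaussianSmoothing_norm hη Θ).differentiableAt,
    fun Θ => (hasFDerivAt_fderiv_gaussianSmoothing_norm hη Θ).differentiableAt, fun Θ => ?_⟩
  · simpa only [baselinePotential_euclideanDecisionSet, multivariateGaussian_zero_one] using
      integrable_norm_affine_stdGaussian η Θ
  · have h1 := radialProfileDeriv_le_zero hη N (sq_nonneg ‖Θ‖)
    have h2 := two_mul_radialProfileDeriv_zero_le hη hN
    have h3 := radialProfileDerivTwo_nonpos N η (‖Θ‖ ^ 2)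
    -- Both coefficients on the right are nonnegative, by `h1`, `h2` and `h3`.
    have e : (1 / (η * √(N : ℝ))) • (1 : Matrix (Fin N) (Fin N) ℝ) -
        hessianMatrix (gaussianSmoothing (baselinePotential (euclideanDecisionSet N)) η 1) Θ =
        (1 / (η * √(N : ℝ)) - 2 * radialProfileDeriv N η (‖Θ‖ ^ 2)) •
          (1 : Matrix (Fin N) (Fin N) ℝ) +
        (-(4 * radialProfileDerivTwo N η (‖Θ‖ ^ 2))) •
          Matrix.vecMulVec Θ.ofLp (star Θ.ofLp) := by
      rw [hessianMatrix_gaussianSmoothing_norm hη, sub_smul, neg_smul]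
      abel
    rw [e]
    exact (Matrix.PosSemidef.one.smul (by linarith)).add
      ((Matrix.posSemidef_vecMulVec_self_star Θ.ofLp).smul (by linarith))
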